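/- Let $N\ge 2$ and $d\ge 2$ be integers and let $(p_n)_{n\ge1}$ be a non-decreasing sequence in $(0,1]$ with $\prod_{n=1}^\infty p_n>0$. Fat fractal percolation is the following random construction. Divide the unit cube $[0,1]^d$ into $N^d$ closed subcubes of side length $N^{-1}$; retain each of them with probability $p_1$ and discard it with probability $1-p_1$. For each $n\ge 2$, divide every cube retained at step $n-1$ into $N^d$ closed subcubes of side length $N^{-n}$ and retain each of these with probability $p_n$, discarding it with probability $1-p_n$; all choices, at all steps, are independent. Let $D_n$ be the union of the cubes retained at step $n$, and let $D=\bigcap_{n\ge1}D_n$ be the limit set. Let $D^{\mathrm{dust}}$ be the dust set, that is, the set of all $x\in D$ whose connected component in $D$ is $\{x\}$, and let $\lambda$ be $d$-dimensional Lebesgue measure. For $n\ge0$, a level-$n$ cube is a cube $c+[0,N^{-n}]^d$ with $c\in\{0,N^{-n},\dots,(N^n-1)N^{-n}\}^d$. (i) If $\prod_{n=1}^\infty p_n^{N^{dn}}=0$, then almost surely $D$ has empty interior. (ii) If $\prod_{n=1}^\infty p_n^{N^{n}}>0$, then $\lambda(D^{\mathrm{dust}})=0$ almost surely. (iii) If $\prod_{n=1}^\infty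 p_n^{N^{dn}}>0$, then almost surely $D$ is the union of a finite (possibly empty) collection of cubes, each of them a level-$n$ cube for some $n\ge0$. -/

import Mathlib

open MeasureTheory Filter Topology

namespace FatFractal

/-- The set `J^d = {0, …, N-1}^d` of positions of the subcubes of side `1/N` in a cube. -/
abbrev Digit (N d : ℕ) : Type := Fin d → Fin N

/-- The set `J^{d,n}` of words of length `n` over `J^d`; they index the level-`n` cubes. -/
abbrev Word (N d n : ℕ) : Type := Fin n → Digit N d

/-- The set `𝒥` of all finite words over `J^d`, of all lengths `n ≥ 0`. -/
abbrev Index (N d : ℕ) : Type := Σ n : ℕ, Word N d n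

/-- The lower corner `c(I)`, with coordinates `∑_{j=1}^n N^{-j} i_{j,t}`. The letter `i_j` is
`I k` with `k = j - 1`. -/
noncomputable def corner {N d n : ℕ} (I : Word N d n) : Fin d → ℝ :=
  fun t => ∑ k : Fin n, (I k t : ℝ) / (N : ℝ) ^ ((k : ℕ) + 1)

/-- The closed level-`n` cube `C(I) = c(I) + [0, N^{-n}]^d`. -/
noncomputable def cube {N d n : ℕ} (I : Word N d n) : Set (Fin d → ℝ) :=
  Set.Icc (corner I) (fun t => corner I t + 1 / (N : ℝ) ^ n)

/-- The first `k` letters of a word of length `n`, where `k < n`. -/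
def initialWord {N d n : ℕ} (I : Word N d n) (k : Fin n) : Word N d (k : ℕ) :=
  fun i => I (Fin.castLE k.isLt.le i)

/-- Configurations: `ω (I, j)` is the value of `Z(I, j)`, with `true` for `1`. -/
abbrev Config (N d : ℕ) : Type := Index N d × Digit N d → Bool

/-- The law on `{0,1}` giving mass `q` to `1` and mass `1 - q` to `0`. -/
noncomputable def coin (q : unitInterval) : Measure Bool :=
  unitInterval.toNNReal q • Measure.dirac true +
    unitInterval.toNNReal (unitInterval.symm q) • Measure.dirac false

instance (q : unitInterval) : IsProbabilityMeasure (coin q) := by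
  unfold coin; infer_instance

/-- The law of fat fractal percolation with retention probabilities `p 1, p 2, …`: the `Z(I, j)`
are independent, and `Z(I, j)` is `1` with probability `p (|I| + 1)`. (`p 0` is not used.) -/
noncomputable def fatLaw (N d : ℕ) (p : ℕ → unitInterval) : Measure (Config N d) :=
  Measure.infinitePi (fun a : Index N d × Digit N d => coin (p (a.1.1 + 1)))

/-- `C(I)` is retained: `Z(i_1) = Z(i_1, i_2) = ⋯ = Z(i_1, …, i_n) = 1`. -/
def Retained {N d n : ℕ} (ω : Config N d) (I : Word N d n) : Prop :=
  ∀ k : Fin n, ω (⟨(k : ℕ), initialWord I k⟩, I k) = true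

/-- `D^n`: the union of the retained closed level-`n` cubes (a finite union, hence closed). -/
def stage {N d : ℕ} (ω : Config N d) (n : ℕ) : Set (Fin d → ℝ) :=
  ⋃ (I : Word N d n) (_ : Retained ω I), cube I

/-- The limit set `D = ⋂_{n ≥ 1} D^n`. -/
def limitSet {N d : ℕ} (ω : Config N d) : Set (Fin d → ℝ) :=
  ⋂ (n : ℕ) (_ : 1 ≤ n), stage ω n

/-- The dust set: the points of the limit set whose connected component in it is a single point. -/
def dust {N d : ℕ} (ω : Config N d) : Set (Fin d → ℝ) :=
  {x ∈ limitSet ω | connectedComponentIn (limitSet ω) x = {x}}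

/-- The infinite product `∏_{n=1}^∞ a n` has the value `L`: the partial products tend to `L`. -/
def InfiniteProductEq (a : ℕ → ℝ) (L : ℝ) : Prop :=
  Tendsto (fun m : ℕ => ∏ n ∈ Finset.Icc 1 m, a n) atTop (𝓝 L)

end FatFractal

/-!
Everything is read off from the set of discarded sites, a site being a non-empty word `(I, j)` with
its own coin `Z(I, j)`.

For (iii), the hypothesis makes the expected number of discarded sites finite, so by Borel–Cantelli
only finitely many sites are discarded, and `D = D^m` for large `m`.

For (ii), fix a coordinate direction. The slab swept out by a level-`n` cube along it has volume
`N^{-(d-1)n}` and there are `N^{dn}` such slabs, so the hypothesis makes the expected total volume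
of the discarded slabs finite. By Borel–Cantelli, now for the points of the cube, almost every point
lies in finitely many discarded slabs: the line through it meets finitely many discarded cubes, so
if the point belongs to `D`, then it lies on a segment of this line contained in `D`.

For (i), a cube `C(I)` of level `m` inside `D` has no discarded descendants. Raising the probability
of this to the power `N^{dm}` turns it into the tail beyond `m` of the given infinite product, which
is zero unless some `p_n` is zero, and then `D` is almost surely empty. A set `D` with interior
points contains one of these countably many cubes.
-/

namespace FatFractal

variable {N d m n : ℕ}

section Words

/-- The word `(I, j)`, obtained from `I` by appending the letter `j`. -/
def child (I : Word N d n) (j : Digit N d) : Word N d (n + 1) :=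
  Fin.snoc (α := fun _ => Digit N d) I j

/-- A site `(I, j)`: the index of a single coin. It stands for the subcube `C(I, j)` of `C(I)`,
which has level `|I| + 1`. -/
abbrev Site (N d : ℕ) : Type := Index N d × Digit N d

/-- The non-empty word `(I, j)` represented by a site. -/
abbrev Site.word (a : Site N d) : Word N d (a.1.1 + 1) := child a.1.2 a.2

theorem child_castSucc (I : Word N d n) (j : Digit N d) (k : Fin n) :
    child I j k.castSucc = I k :=
  Fin.snoc_castSucc (α := fun _ => Digit N d) j I k

theorem child_last (I : Word N d n) (j : Digit N d) : child I j (Fin.last n) = j :=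
  Fin.snoc_last (α := fun _ => Digit N d) j I

theorem exists_eq_child (J : Word N d (n + 1)) :
    ∃ (I : Word N d n) (j : Digit N d), J = child I j :=
  ⟨Fin.init (α := fun _ => Digit N d) J, J (Fin.last n), (Fin.snoc_init_self _).symm⟩

theorem initialWord_child_castSucc (I : Word N d n) (j : Digit N d) (k : Fin n) :
    initialWord (child I j) k.castSucc = initialWord I k :=
  funext fun i => child_castSucc I j (Fin.castLE k.isLt.le i)

theorem initialWord_child_last (I : Word N d n) (j : Digit N d) :
    initialWord (child I j) (Fin.last n) = I :=
  funext fun i => child_castSucc I j i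

theorem retained_child {ω : Config N d} {I : Word N d n} {j : Digit N d} :
    Retained ω (child I j) ↔ Retained ω I ∧ ω (⟨n, I⟩, j) = true := by
  have hlast : (⟨n, initialWord (child I j) (Fin.last n)⟩ : Index N d) = ⟨n, I⟩ :=
    congrArg (Sigma.mk n) (initialWord_child_last I j)
  simp only [Retained, Fin.forall_fin_succ', child_castSucc, child_last,
    initialWord_child_castSucc]
  exact and_congr_right' (iff_of_eq (congrArg (fun J => ω (J, j) = true) hlast))

theorem card_word_mul_card_digit (N d n : ℕ) :
    Fintype.card (Word N d n) * Fintype.card (Digit N d) = N ^ (d * (n + 1)) := by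
  simp only [Fintype.card_pi, Fintype.card_fin, Finset.prod_const, Finset.card_univ]
  rw [← pow_mul, ← pow_add, mul_add_one]

theorem tsum_site (f : ℕ → ENNReal) :
    ∑' a : Site N d, f a.1.1 = ∑' n, (N ^ (d * (n + 1)) : ℕ) * f n := by
  rw [ENNReal.tsum_prod', ENNReal.tsum_sigma']
  refine tsum_congr fun n => ?_
  simp only [tsum_fintype, Finset.sum_const, Finset.card_univ, nsmul_eq_mul]
  rw [← card_word_mul_card_digit, Nat.cast_mul, mul_assoc]

/-- The sites `(I, j)` with `|I| < M`. -/
def sitesBelow (N d M : ℕ) : Finset (Site N d) :=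
  ((Finset.range M).sigma fun _ => Finset.univ) ×ˢ Finset.univ

theorem prod_sitesBelow {α : Type*} [CommMonoid α] (f : ℕ → α) (M : ℕ) :
    ∏ a ∈ sitesBelow N d M, f a.1.1 = ∏ k ∈ Finset.range M, f k ^ N ^ (d * (k + 1)) := by
  rw [sitesBelow, Finset.prod_product, Finset.prod_sigma]
  refine Finset.prod_congr rfl fun k _ => ?_
  simp only [Finset.prod_const, Finset.card_univ]
  rw [← pow_mul, mul_comm, card_word_mul_card_digit]

theorem exists_forall_level_lt {S : Set (Site N d)} (hS : S.Finite) :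
    ∃ m, ∀ a ∈ S, a.1.1 < m := by
  obtain ⟨m, hm⟩ := (hS.image fun a => a.1.1).bddAbove
  exact ⟨m + 1, fun a ha => Nat.lt_succ_of_le (hm ⟨a, ha, rfl⟩)⟩

/-- Prefixing a word to a site: `(W, j)` becomes `(I, W, j)`. The range consists of the sites
strictly below the cube `C(I)`. -/
def prepend (I : Word N d m) : Site N d ↪ Site N d where
  toFun a := (⟨m + a.1.1, Fin.append I a.1.2⟩, a.2)
  inj' := by
    rintro ⟨⟨k, W⟩, j⟩ ⟨⟨k', W'⟩, j'⟩ h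
    simp only [Prod.mk.injEq, Sigma.mk.injEq, Nat.add_left_cancel_iff] at h
    obtain ⟨⟨rfl, hW⟩, rfl⟩ := h
    have hIW : (I, W) = (I, W') := (Fin.appendEquiv m k).injective (eq_of_heq hW)
    rw [(Prod.mk.inj hIW).2]

end Words

section Cubes

variable {I J : Word N d n} {x : Fin d → ℝ}

theorem corner_child (I : Word N d n) (j : Digit N d) (t : Fin d) :
    corner (child I j) t = corner I t + (j t : ℝ) / (N : ℝ) ^ (n + 1) := by
  simp only [corner, Fin.sum_univ_castSucc, child_castSucc, child_last, Fin.val_castSucc,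
    Fin.val_last]

theorem mem_cube : x ∈ cube I ↔ ∀ t, x t ∈ Set.Icc (corner I t) (corner I t + 1 / (N : ℝ) ^ n) := by
  simp only [cube, Set.mem_Icc, Pi.le_def, forall_and]

theorem interior_cube (I : Word N d n) :
    interior (cube I) =
      Set.univ.pi fun t => Set.Ioo (corner I t) (corner I t + 1 / (N : ℝ) ^ n) := by
  simp only [cube, ← Set.pi_univ_Icc, interior_pi_set Set.finite_univ, interior_Icc]

theorem interior_cube_nonempty (hN : 0 < N) (I : Word N d n) : (interior (cube I)).Nonempty := by
  rw [interior_cube, Set.univ_pi_nonempty_iff]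
  exact fun t => Set.nonempty_Ioo.2 (lt_add_of_pos_right _ (by positivity))

theorem cube_subset_closedBall (hx : x ∈ cube I) :
    cube I ⊆ Metric.closedBall x (1 / (N : ℝ) ^ n) := by
  intro y hy
  refine (dist_pi_le_iff (by positivity)).2 fun t => ?_
  simpa using Real.dist_le_of_mem_Icc (mem_cube.1 hy t) (mem_cube.1 hx t)

theorem digit_div_add_le (j : Fin N) (n : ℕ) :
    (j : ℝ) / (N : ℝ) ^ (n + 1) + 1 / (N : ℝ) ^ (n + 1) ≤ 1 / (N : ℝ) ^ n := by
  have hN : (0 : ℝ) < N := by exact_mod_cast j.pos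
  have hj : (j : ℝ) + 1 ≤ N := by exact_mod_cast j.isLt
  calc (j : ℝ) / (N : ℝ) ^ (n + 1) + 1 / (N : ℝ) ^ (n + 1)
      = ((j : ℝ) + 1) / (N : ℝ) ^ (n + 1) := by rw [add_div]
    _ ≤ N / (N : ℝ) ^ (n + 1) := by gcongr
    _ = 1 / (N : ℝ) ^ n := by rw [pow_succ]; field_simp

theorem cube_child_subset (I : Word N d n) (j : Digit N d) : cube (child I j) ⊆ cube I := by
  intro x hx
  rw [mem_cube] at hx ⊢
  intro t
  have hxt := hx t
  rw [corner_child] at hxt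
  have hj : (0 : ℝ) ≤ (j t : ℝ) / (N : ℝ) ^ (n + 1) := by positivity
  have hj' := digit_div_add_le (j t) n
  constructor <;> linarith [hxt.1, hxt.2]

theorem cube_append_subset (I : Word N d m) {k : ℕ} (W : Word N d k) :
    cube (Fin.append I W : Word N d (m + k)) ⊆ cube I := by
  induction k with
  | zero =>
    obtain rfl : W = Fin.elim0 := Subsingleton.elim _ _
    rw [Fin.append_elim0]
    rfl
  | succ k ih =>
    obtain ⟨W, j, rfl⟩ := exists_eq_child W
    have happend : (Fin.append I (child W j) : Word N d (m + (k + 1))) =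
        child (Fin.append I W : Word N d (m + k)) j := Fin.append_snoc I W j
    rw [happend]
    exact (cube_child_subset _ _).trans (ih W)

theorem cube_prepend_subset (I : Word N d m) (a : Site N d) : cube (prepend I a).word ⊆ cube I :=
  (cube_child_subset _ _).trans (cube_append_subset I a.1.2)

theorem cube_subset_Icc_zero_one (I : Word N d n) : cube I ⊆ Set.Icc 0 1 := by
  induction n with
  | zero =>
    intro x hx
    simp only [mem_cube, corner, Finset.univ_eq_empty, Finset.sum_empty, pow_zero, div_one,
      zero_add] at hx
    exact ⟨fun t => (hx t).1, fun t => (hx t).2⟩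
  | succ n ih =>
    obtain ⟨I, j, rfl⟩ := exists_eq_child I
    exact (cube_child_subset I j).trans (ih I)

theorem exists_fin_le_and_le_add_one (hN : 0 < N) {v : ℝ} (hv₀ : 0 ≤ v) (hvN : v ≤ N) :
    ∃ j : Fin N, (j : ℝ) ≤ v ∧ v ≤ j + 1 := by
  rcases hvN.eq_or_lt with rfl | hlt
  · refine ⟨⟨N - 1, by omega⟩, ?_⟩
    rw [Fin.val_mk, Nat.cast_pred hN]
    constructor <;> linarith
  · exact ⟨⟨⌊v⌋₊, (Nat.floor_lt hv₀).2 hlt⟩, Nat.floor_le hv₀, (Nat.lt_floor_add_one v).le⟩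

theorem exists_digit_mem_Icc (hN : 0 < N) {c u : ℝ} (hu : u ∈ Set.Icc c (c + 1 / (N : ℝ) ^ n)) :
    ∃ j : Fin N, u ∈ Set.Icc (c + (j : ℝ) / (N : ℝ) ^ (n + 1))
      (c + (j : ℝ) / (N : ℝ) ^ (n + 1) + 1 / (N : ℝ) ^ (n + 1)) := by
  have hP : (0 : ℝ) < (N : ℝ) ^ (n + 1) := by positivity
  have hscale : (u - c) * (N : ℝ) ^ (n + 1) ≤ N := by
    calc (u - c) * (N : ℝ) ^ (n + 1) ≤ 1 / (N : ℝ) ^ n * (N : ℝ) ^ (n + 1) := by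
          gcongr; linarith [hu.2]
      _ = N := by rw [pow_succ]; field_simp
  obtain ⟨j, hj, hj'⟩ :=
    exists_fin_le_and_le_add_one hN (mul_nonneg (sub_nonneg.2 hu.1) hP.le) hscale
  rw [← div_le_iff₀ hP] at hj
  rw [← le_div_iff₀ hP, add_div] at hj'
  exact ⟨j, by linarith, by linarith⟩

theorem exists_mem_cube_child (hN : 0 < N) (hx : x ∈ cube I) :
    ∃ j : Digit N d, x ∈ cube (child I j) := by
  choose j hj using fun t => exists_digit_mem_Icc hN (mem_cube.1 hx t)
  exact ⟨j, mem_cube.2 fun t => by rw [corner_child]; exact hj t⟩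

theorem eq_of_mem_interior_cube_of_mem_cube (hI : x ∈ interior (cube I)) (hJ : x ∈ cube J) :
    J = I := by
  induction n with
  | zero => exact Subsingleton.elim _ _
  | succ n ih =>
    obtain ⟨I, i, rfl⟩ := exists_eq_child I
    obtain ⟨J, j, rfl⟩ := exists_eq_child J
    obtain rfl : J = I :=
      ih (interior_mono (cube_child_subset I i) hI) (cube_child_subset J j hJ)
    congr 1
    funext t
    have hN : 0 < N := (i t).pos
    have hP : (0 : ℝ) < (N : ℝ) ^ (n + 1) := by positivity
    rw [interior_cube] at hI
    obtain ⟨hI₁, hI₂⟩ := hI t trivial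
    obtain ⟨hJ₁, hJ₂⟩ := mem_cube.1 hJ t
    rw [corner_child] at hI₁ hI₂ hJ₁ hJ₂
    have hij : (i t : ℝ) / (N : ℝ) ^ (n + 1) < ((j t : ℝ) + 1) / (N : ℝ) ^ (n + 1) := by
      rw [add_div]; linarith
    have hji : (j t : ℝ) / (N : ℝ) ^ (n + 1) < ((i t : ℝ) + 1) / (N : ℝ) ^ (n + 1) := by
      rw [add_div]; linarith
    rw [div_lt_div_iff_of_pos_right hP] at hij hji
    norm_cast at hij hji
    exact Fin.ext (by omega)

end Cubes

section LimitSet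

variable {ω : Config N d} {x : Fin d → ℝ}

theorem mem_stage : x ∈ stage ω n ↔ ∃ I : Word N d n, Retained ω I ∧ x ∈ cube I := by
  simp only [stage, Set.mem_iUnion, exists_prop]

theorem stage_antitone (ω : Config N d) : Antitone (stage ω) := by
  refine antitone_nat_of_succ_le fun n x hx => ?_
  obtain ⟨J, hJ, hxJ⟩ := mem_stage.1 hx
  obtain ⟨I, j, rfl⟩ := exists_eq_child J
  exact mem_stage.2 ⟨I, (retained_child.1 hJ).1, cube_child_subset I j hxJ⟩

theorem limitSet_subset_stage (ω : Config N d) (n : ℕ) : limitSet ω ⊆ stage ω n :=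
  (Set.biInter_subset_of_mem n.succ_pos).trans (stage_antitone ω n.le_succ)

theorem mem_limitSet_of_forall_eq_true (hN : 0 < N) (hx : x ∈ stage ω m)
    (h : ∀ a : Site N d, m ≤ a.1.1 → x ∈ cube a.word → ω a = true) : x ∈ limitSet ω := by
  have hstage (n : ℕ) (hmn : m ≤ n) : x ∈ stage ω n := by
    induction n, hmn using Nat.le_induction with
    | base => exact hx
    | succ n hmn ih =>
      obtain ⟨I, hI, hxI⟩ := mem_stage.1 ih
      obtain ⟨j, hj⟩ := exists_mem_cube_child hN hxI
      exact mem_stage.2 ⟨child I j, retained_child.2 ⟨hI, h (⟨n, I⟩, j) hmn hj⟩, hj⟩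
  exact Set.mem_iInter₂.2 fun n _ =>
    stage_antitone ω (le_max_left n m) (hstage _ (le_max_right n m))

theorem limitSet_eq_stage_of_forall_eq_true (hN : 0 < N)
    (h : ∀ a : Site N d, m ≤ a.1.1 → ω a = true) : limitSet ω = stage ω m :=
  (limitSet_subset_stage ω m).antisymm fun _ hx =>
    mem_limitSet_of_forall_eq_true hN hx fun a ha _ => h a ha

theorem exists_stage_eq_biUnion_cube (ω : Config N d) (m : ℕ) :
    ∃ S : Finset (Index N d), stage ω m = ⋃ I ∈ S, cube I.2 := by
  classical
  refine ⟨(Finset.univ.filter fun I : Word N d m => Retained ω I).map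
    ⟨Sigma.mk m, sigma_mk_injective⟩, ?_⟩
  ext x
  simp [mem_stage]

theorem exists_limitSet_eq_biUnion_cube_of_finite (hN : 0 < N) (h : {a | ω a = false}.Finite) :
    ∃ S : Finset (Index N d), limitSet ω = ⋃ I ∈ S, cube I.2 := by
  obtain ⟨m, hm⟩ := exists_forall_level_lt h
  rw [limitSet_eq_stage_of_forall_eq_true hN fun a ha =>
    by_contra fun hf => (hm a (Bool.eq_false_of_not_eq_true hf)).not_ge ha]
  exact exists_stage_eq_biUnion_cube ω m

theorem eq_true_of_cube_word_subset_limitSet (hN : 0 < N) {a : Site N d}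
    (h : cube a.word ⊆ limitSet ω) : ω a = true := by
  obtain ⟨x, hx⟩ := interior_cube_nonempty hN a.word
  obtain ⟨J, hJ, hxJ⟩ := mem_stage.1 (limitSet_subset_stage ω _ (h (interior_subset hx)))
  obtain rfl := eq_of_mem_interior_cube_of_mem_cube hx hxJ
  exact (retained_child.1 hJ).2

theorem exists_cube_subset_limitSet (hN : 2 ≤ N) (h : (interior (limitSet ω)).Nonempty) :
    ∃ I : Index N d, cube I.2 ⊆ limitSet ω := by
  obtain ⟨x, hx⟩ := h
  obtain ⟨ε, hε, hball⟩ := Metric.isOpen_iff.1 isOpen_interior x hx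
  obtain ⟨n, hn⟩ := exists_pow_lt_of_lt_one hε
    (inv_lt_one_of_one_lt₀ (by exact_mod_cast hN : (1 : ℝ) < N))
  rw [inv_pow, ← one_div] at hn
  obtain ⟨I, -, hxI⟩ := mem_stage.1 (limitSet_subset_stage ω n (interior_subset hx))
  exact ⟨⟨n, I⟩, fun y hy =>
    interior_subset (hball (Metric.closedBall_subset_ball hn (cube_subset_closedBall hxI hy)))⟩

end LimitSet

section InfiniteProducts

variable {a : ℕ → ℝ} {L : ℝ}

theorem infiniteProductEq_iff_tendsto_prod_range :
    InfiniteProductEq a L ↔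
      Tendsto (fun m => ∏ n ∈ Finset.range m, a (n + 1)) atTop (𝓝 L) := by
  have hprod (m : ℕ) : ∏ n ∈ Finset.Icc 1 m, a n = ∏ n ∈ Finset.range m, a (n + 1) := by
    rw [Finset.range_eq_Ico, Finset.prod_Ico_add' a 0 m 1]
    rfl
  simp only [InfiniteProductEq, hprod]

theorem InfiniteProductEq.le_prod_range (h : InfiniteProductEq a L) (ha₀ : ∀ n, 0 ≤ a n)
    (ha₁ : ∀ n, a n ≤ 1) (m : ℕ) : L ≤ ∏ n ∈ Finset.range m, a (n + 1) := by
  have hanti : Antitone fun m => ∏ n ∈ Finset.range m, a (n + 1) := by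
    refine antitone_nat_of_succ_le fun m => ?_
    rw [Finset.prod_range_succ]
    exact mul_le_of_le_one_right (Finset.prod_nonneg fun n _ => ha₀ _) (ha₁ _)
  exact hanti.le_of_tendsto (infiniteProductEq_iff_tendsto_prod_range.1 h) m

theorem InfiniteProductEq.tendsto_prod_range_add_zero (h : InfiniteProductEq a 0)
    (ha : ∀ n, 1 ≤ n → a n ≠ 0) (m : ℕ) :
    Tendsto (fun M => ∏ k ∈ Finset.range M, a (m + k + 1)) atTop (𝓝 0) := by
  have hhead : ∏ n ∈ Finset.range m, a (n + 1) ≠ 0 :=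
    Finset.prod_ne_zero_iff.2 fun n _ => ha _ n.succ_pos
  have htail := ((tendsto_add_atTop_iff_nat m).2
    (infiniteProductEq_iff_tendsto_prod_range.1 h)).const_mul (∏ n ∈ Finset.range m, a (n + 1))⁻¹
  simpa only [add_comm _ m, Finset.prod_range_add, inv_mul_cancel_left₀ hhead, mul_zero]
    using htail

theorem pow_le_exp_neg_mul_one_sub {q : ℝ} (hq : 0 ≤ q) (k : ℕ) :
    q ^ k ≤ Real.exp (-(k * (1 - q))) := by
  calc q ^ k ≤ Real.exp (-(1 - q)) ^ k :=
        pow_le_pow_left₀ hq (by linarith [Real.one_sub_le_exp_neg (1 - q)]) k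
    _ = Real.exp (-(k * (1 - q))) := by rw [← Real.exp_nat_mul, mul_neg]

theorem summable_mul_one_sub_of_le_prod_pow {q : ℕ → ℝ} {k : ℕ → ℕ} (hq₀ : ∀ n, 0 ≤ q n)
    (hq₁ : ∀ n, q n ≤ 1) (hL : 0 < L) (h : ∀ m, L ≤ ∏ n ∈ Finset.range m, q n ^ k n) :
    Summable fun n => (k n : ℝ) * (1 - q n) := by
  refine summable_of_sum_range_le (c := -Real.log L)
    (fun n => mul_nonneg (Nat.cast_nonneg _) (sub_nonneg.2 (hq₁ n))) fun m => ?_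
  have hexp : L ≤ Real.exp (-∑ n ∈ Finset.range m, (k n : ℝ) * (1 - q n)) := by
    rw [← Finset.sum_neg_distrib, Real.exp_sum]
    exact (h m).trans (Finset.prod_le_prod (fun n _ => pow_nonneg (hq₀ n) _)
      fun n _ => pow_le_exp_neg_mul_one_sub (hq₀ n) _)
  linarith [(Real.log_le_iff_le_exp hL).2 hexp]

theorem InfiniteProductEq.summable_mul_one_sub {p : ℕ → unitInterval} {k : ℕ → ℕ}
    (h : InfiniteProductEq (fun n => (p n : ℝ) ^ k n) L) (hL : 0 < L) :
    Summable fun n => (k (n + 1) : ℝ) * (1 - p (n + 1)) :=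
  summable_mul_one_sub_of_le_prod_pow (fun n => (p (n + 1)).2.1) (fun n => (p (n + 1)).2.2) hL
    (h.le_prod_range (fun n => pow_nonneg (p n).2.1 _) fun n => pow_le_one₀ (p n).2.1 (p n).2.2)

end InfiniteProducts

section Law

variable (p : ℕ → unitInterval)

theorem coe_toNNReal_eq_ofReal (q : unitInterval) :
    (unitInterval.toNNReal q : ENNReal) = ENNReal.ofReal q := by
  rw [← unitInterval.coe_toNNReal, ENNReal.ofReal_coe_nnreal]

theorem coin_singleton_true (q : unitInterval) : coin q {true} = ENNReal.ofReal q := by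
  simp [coin, ENNReal.smul_def, coe_toNNReal_eq_ofReal]

theorem coin_singleton_false (q : unitInterval) : coin q {false} = ENNReal.ofReal (1 - q) := by
  simp [coin, ENNReal.smul_def, coe_toNNReal_eq_ofReal]

theorem measurableSet_eq_false (a : Site N d) : MeasurableSet {ω : Config N d | ω a = false} :=
  (measurableSet_singleton false).preimage (measurable_pi_apply a)

theorem fatLaw_eq_false (a : Site N d) :
    fatLaw N d p {ω | ω a = false} = ENNReal.ofReal (1 - p (a.1.1 + 1)) := by
  rw [← coin_singleton_false]
  exact (measurePreserving_eval_infinitePi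
    (fun a : Site N d => coin (p (a.1.1 + 1))) a).measure_preimage
      (measurableSet_singleton false).nullMeasurableSet

theorem fatLaw_forall_eq_true (s : Finset (Site N d)) :
    fatLaw N d p {ω | ∀ a ∈ s, ω a = true} = ∏ a ∈ s, ENNReal.ofReal (p (a.1.1 + 1)) := by
  simp_rw [← coin_singleton_true]
  exact Measure.infinitePi_pi (fun a : Site N d => coin (p (a.1.1 + 1)))
    (s := s) (t := fun _ => {true}) fun _ _ => measurableSet_singleton true

end Law

section FiniteUnion

variable {p : ℕ → unitInterval} {L : ℝ}

theorem tsum_fatLaw_eq_false_ne_top (hL : 0 < L)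
    (h : InfiniteProductEq (fun n => (p n : ℝ) ^ N ^ (d * n)) L) :
    ∑' a : Site N d, fatLaw N d p {ω | ω a = false} ≠ ⊤ := by
  simp_rw [fatLaw_eq_false]
  rw [tsum_site fun n => ENNReal.ofReal (1 - p (n + 1))]
  convert (h.summable_mul_one_sub hL).tsum_ofReal_ne_top using 3 with n
  rw [ENNReal.ofReal_mul (Nat.cast_nonneg _), ENNReal.ofReal_natCast]

theorem ae_exists_limitSet_eq_biUnion_cube (hN : 0 < N) (hL : 0 < L)
    (h : InfiniteProductEq (fun n => (p n : ℝ) ^ N ^ (d * n)) L) :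
    ∀ᵐ ω ∂fatLaw N d p, ∃ S : Finset (Index N d), limitSet ω = ⋃ I ∈ S, cube I.2 := by
  filter_upwards [ae_finite_setOfPred_mem (tsum_fatLaw_eq_false_ne_top hL h)] with ω hω
  exact exists_limitSet_eq_biUnion_cube_of_finite hN hω

end FiniteUnion

section EmptyInterior

variable (p : ℕ → unitInterval)

theorem fatLaw_forall_prepend_eq_true (I : Word N d m) (M : ℕ) :
    fatLaw N d p {ω | ∀ a ∈ sitesBelow N d M, ω (prepend I a) = true} =
      ∏ k ∈ Finset.range M, ENNReal.ofReal (p (m + k + 1)) ^ N ^ (d * (k + 1)) := by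
  have hmap := fatLaw_forall_eq_true p ((sitesBelow N d M).map (prepend I))
  simp only [Finset.forall_mem_map, Finset.prod_map] at hmap
  rw [hmap, ← prod_sitesBelow fun k => ENNReal.ofReal (p (m + k + 1))]
  rfl

theorem fatLaw_cube_subset_limitSet_pow_le (hN : 0 < N) (I : Word N d m) (M : ℕ) :
    fatLaw N d p {ω | cube I ⊆ limitSet ω} ^ N ^ (d * m) ≤
      ENNReal.ofReal (∏ k ∈ Finset.range M, (p (m + k + 1) : ℝ) ^ N ^ (d * (m + k + 1))) := by
  calc fatLaw N d p {ω | cube I ⊆ limitSet ω} ^ N ^ (d * m)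
      ≤ fatLaw N d p {ω | ∀ a ∈ sitesBelow N d M, ω (prepend I a) = true} ^ N ^ (d * m) := by
        gcongr
        exact fun hI a _ =>
          eq_true_of_cube_word_subset_limitSet hN ((cube_prepend_subset I a).trans hI)
    _ = ∏ k ∈ Finset.range M, ENNReal.ofReal (p (m + k + 1)) ^ N ^ (d * (m + k + 1)) := by
        rw [fatLaw_forall_prepend_eq_true, ← Finset.prod_pow]
        refine Finset.prod_congr rfl fun k _ => ?_
        rw [← pow_mul, ← pow_add, ← mul_add, add_comm (k + 1), add_assoc]
    _ = _ := by
        rw [ENNReal.ofReal_prod_of_nonneg fun k _ => pow_nonneg (p (m + k + 1)).2.1 _]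
        exact Finset.prod_congr rfl fun k _ => (ENNReal.ofReal_pow (p (m + k + 1)).2.1 _).symm

variable {p}

theorem fatLaw_cube_subset_limitSet_eq_zero (hN : 0 < N) (hp : ∀ n, 1 ≤ n → p n ≠ 0)
    (h : InfiniteProductEq (fun n => (p n : ℝ) ^ N ^ (d * n)) 0) (I : Word N d m) :
    fatLaw N d p {ω | cube I ⊆ limitSet ω} = 0 := by
  have htail := ENNReal.tendsto_ofReal <| h.tendsto_prod_range_add_zero
    (fun n hn => pow_ne_zero _ (unitInterval.coe_ne_zero.2 (hp n hn))) m
  rw [ENNReal.ofReal_zero] at htail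
  exact eq_zero_of_pow_eq_zero <|
    nonpos_iff_eq_zero.1 <| ge_of_tendsto' htail (fatLaw_cube_subset_limitSet_pow_le p hN I)

theorem ae_limitSet_eq_empty (hn : 1 ≤ n) (hp : p n = 0) :
    ∀ᵐ ω ∂fatLaw N d p, limitSet ω = ∅ := by
  obtain ⟨k, rfl⟩ := Nat.exists_eq_add_of_le' hn
  have hfalse (I : Word N d k) (j : Digit N d) :
      ∀ᵐ ω ∂fatLaw N d p, ¬ω (⟨k, I⟩, j) = true := by
    rw [ae_iff]
    simpa [hp] using fatLaw_forall_eq_true p {((⟨k, I⟩, j) : Site N d)}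
  filter_upwards [ae_all_iff.2 fun I => ae_all_iff.2 (hfalse I)] with ω hω
  refine Set.eq_empty_of_forall_notMem fun x hx => ?_
  obtain ⟨J, hJ, -⟩ := mem_stage.1 (limitSet_subset_stage ω (k + 1) hx)
  obtain ⟨I, j, rfl⟩ := exists_eq_child J
  exact hω I j (retained_child.1 hJ).2

theorem ae_interior_limitSet_eq_empty (hN : 2 ≤ N)
    (h : InfiniteProductEq (fun n => (p n : ℝ) ^ N ^ (d * n)) 0) :
    ∀ᵐ ω ∂fatLaw N d p, interior (limitSet ω) = ∅ := by
  by_cases hp : ∀ n, 1 ≤ n → p n ≠ 0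
  · have hcube (I : Index N d) : ∀ᵐ ω ∂fatLaw N d p, ¬cube I.2 ⊆ limitSet ω := by
      simpa only [ae_iff, not_not] using
        fatLaw_cube_subset_limitSet_eq_zero (by omega) hp h I.2
    filter_upwards [ae_all_iff.2 hcube] with ω hω
    by_contra hne
    obtain ⟨I, hI⟩ := exists_cube_subset_limitSet hN (Set.nonempty_iff_ne_empty.2 hne)
    exact hω I hI
  · push Not at hp
    obtain ⟨n, hn, hpn⟩ := hp
    filter_upwards [ae_limitSet_eq_empty hn hpn] with ω hω
    rw [hω, interior_empty]

end EmptyInterior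

section Dust

theorem ae_ae_finite_setOfPred_mem_of_tsum_mul_ne_top {ι Ω X : Type*} [Countable ι]
    [MeasurableSpace Ω] [MeasurableSpace X] {P : Measure Ω} {μ : Measure X} {A : ι → Set Ω}
    {B : ι → Set X} (hA : ∀ i, MeasurableSet (A i)) (h : ∑' i, P (A i) * μ (B i) ≠ ⊤) :
    ∀ᵐ ω ∂P, ∀ᵐ x ∂μ, {i | ω ∈ A i ∧ x ∈ B i}.Finite := by
  let F (i : ι) : Ω → ENNReal := (A i).indicator fun _ => μ (B i)
  have hF (i : ι) : Measurable (F i) := measurable_const.indicator (hA i)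
  have hint : ∫⁻ ω, ∑' i, F i ω ∂P ≠ ⊤ := by
    simpa only [F, lintegral_tsum fun i => (hF i).aemeasurable, lintegral_indicator_const (hA _),
      mul_comm] using h
  filter_upwards [ae_lt_top (Measurable.tsum hF) hint] with ω hω
  refine ae_finite_setOfPred_mem (s := fun i => {x | ω ∈ A i ∧ x ∈ B i}) ?_
  refine ne_of_eq_of_ne (tsum_congr fun i => ?_) hω.ne
  by_cases hi : ω ∈ A i <;> simp [F, hi]

variable {ω : Config N d} {t₀ : Fin d} {x : Fin d → ℝ}

/-- The slab over `C(I)` in direction `t₀`: the points of the unit cube whose line in this direction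
meets `C(I)`. -/
noncomputable def slab (t₀ : Fin d) (I : Word N d n) : Set (Fin d → ℝ) :=
  Set.Icc (Function.update (corner I) t₀ 0)
    (Function.update (fun t => corner I t + 1 / (N : ℝ) ^ n) t₀ 1)

theorem volume_slab (t₀ : Fin d) (I : Word N d n) :
    volume (slab t₀ I) = ENNReal.ofReal ((1 / (N : ℝ) ^ n) ^ (d - 1)) := by
  rw [slab, Real.volume_Icc_pi, ← Finset.mul_prod_erase _ _ (Finset.mem_univ t₀),
    Finset.prod_congr rfl (g := fun _ => ENNReal.ofReal (1 / (N : ℝ) ^ n))]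
  · rw [Finset.prod_const, Finset.card_erase_of_mem (Finset.mem_univ _), Finset.card_univ,
      Fintype.card_fin, ← ENNReal.ofReal_pow (by positivity)]
    simp
  · intro t ht
    simp [Function.update_of_ne (Finset.ne_of_mem_erase ht)]

theorem mem_slab_of_update_mem_cube {I : Word N d n} {r : ℝ} (hx : x ∈ Set.Icc (0 : Fin d → ℝ) 1)
    (hr : Function.update x t₀ r ∈ cube I) : x ∈ slab t₀ I := by
  have hxI (t : Fin d) (ht : t ≠ t₀) :
      x t ∈ Set.Icc (corner I t) (corner I t + 1 / (N : ℝ) ^ n) := by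
    simpa only [Function.update_of_ne ht] using mem_cube.1 hr t
  exact ⟨update_le_iff.2 ⟨hx.1 t₀, fun t ht => (hxI t ht).1⟩,
    le_update_iff.2 ⟨hx.2 t₀, fun t ht => (hxI t ht).2⟩⟩

theorem update_mem_cube {I : Word N d n} {r : ℝ} (hx : x ∈ cube I)
    (hr : r ∈ Set.Icc (corner I t₀) (corner I t₀ + 1 / (N : ℝ) ^ n)) :
    Function.update x t₀ r ∈ cube I :=
  ⟨le_update_iff.2 ⟨hr.1, fun t _ => hx.1 t⟩, update_le_iff.2 ⟨hr.2, fun t _ => hx.2 t⟩⟩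

theorem notMem_dust_of_forall_update_mem_limitSet {a b : ℝ} (hab : a < b)
    (hx : x t₀ ∈ Set.Icc a b) (h : ∀ r ∈ Set.Icc a b, Function.update x t₀ r ∈ limitSet ω) :
    x ∉ dust ω := by
  rintro ⟨-, hcomp⟩
  have hconn : IsPreconnected (Function.update x t₀ '' Set.Icc a b) :=
    isPreconnected_Icc.image _ (by fun_prop)
  have hsub := hconn.subset_connectedComponentIn ⟨x t₀, hx, Function.update_eq_self t₀ x⟩
    (Set.forall_mem_image.2 fun r hr => h r hr)
  rw [hcomp] at hsub
  have heq (r : ℝ) (hr : r ∈ Set.Icc a b) : r = x t₀ :=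
    (Function.update_eq_iff.1 (Set.mem_singleton_iff.1 (hsub ⟨r, hr, rfl⟩))).1
  have hax := heq a (Set.left_mem_Icc.2 hab.le)
  have hbx := heq b (Set.right_mem_Icc.2 hab.le)
  exact hab.ne (hax.trans hbx.symm)

theorem notMem_dust_of_finite (hN : 0 < N)
    (h : {a : Site N d | ω a = false ∧ x ∈ slab t₀ a.word}.Finite) : x ∉ dust ω := by
  intro hx
  obtain ⟨m, hm⟩ := exists_forall_level_lt h
  obtain ⟨I, hI, hxI⟩ := mem_stage.1 (limitSet_subset_stage ω m hx.1)
  refine notMem_dust_of_forall_update_mem_limitSet (lt_add_of_pos_right _ (by positivity))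
    (mem_cube.1 hxI t₀) (fun r hr => ?_) hx
  refine mem_limitSet_of_forall_eq_true hN
    (mem_stage.2 ⟨I, hI, update_mem_cube hxI hr⟩) fun a ha hra => ?_
  by_contra hf
  have hslab := mem_slab_of_update_mem_cube (cube_subset_Icc_zero_one I hxI) hra
  exact (hm a ⟨Bool.eq_false_of_not_eq_true hf, hslab⟩).not_ge ha

theorem pow_mul_one_div_pow_sub_one (hN : 0 < N) (hd : 0 < d) (n : ℕ) :
    (N : ℝ) ^ (d * n) * (1 / (N : ℝ) ^ n) ^ (d - 1) = (N : ℝ) ^ n := by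
  obtain ⟨e, rfl⟩ := Nat.exists_eq_add_of_le' hd
  have hN' : (N : ℝ) ≠ 0 := by exact_mod_cast hN.ne'
  rw [Nat.add_sub_cancel, one_div, inv_pow, ← pow_mul, ← div_eq_mul_inv,
    div_eq_iff (pow_ne_zero _ hN'), ← pow_add]
  ring

variable {p : ℕ → unitInterval} {L : ℝ}

theorem tsum_fatLaw_eq_false_mul_volume_slab_ne_top (hN : 0 < N) (t₀ : Fin d) (hL : 0 < L)
    (h : InfiniteProductEq (fun n => (p n : ℝ) ^ N ^ n) L) :
    ∑' a : Site N d, fatLaw N d p {ω | ω a = false} * volume (slab t₀ a.word) ≠ ⊤ := by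
  simp_rw [fatLaw_eq_false, volume_slab]
  rw [tsum_site fun n => ENNReal.ofReal (1 - p (n + 1)) *
    ENNReal.ofReal ((1 / (N : ℝ) ^ (n + 1)) ^ (d - 1))]
  convert (h.summable_mul_one_sub hL).tsum_ofReal_ne_top using 3 with n
  rw [mul_left_comm, ← ENNReal.ofReal_natCast, ← ENNReal.ofReal_mul (by positivity),
    Nat.cast_pow, Nat.cast_pow, pow_mul_one_div_pow_sub_one hN t₀.pos, mul_comm,
    ← ENNReal.ofReal_mul (by positivity)]

theorem ae_volume_dust_eq_zero (hN : 0 < N) (hd : 0 < d) (hL : 0 < L)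
    (h : InfiniteProductEq (fun n => (p n : ℝ) ^ N ^ n) L) :
    ∀ᵐ ω ∂fatLaw N d p, volume (dust ω) = 0 := by
  filter_upwards [ae_ae_finite_setOfPred_mem_of_tsum_mul_ne_top measurableSet_eq_false
    (tsum_fatLaw_eq_false_mul_volume_slab_ne_top hN ⟨0, hd⟩ hL h)] with ω hω
  exact measure_mono_null (fun x hx hfin => notMem_dust_of_finite hN hfin hx) (ae_iff.1 hω)

end Dust

end FatFractal

theorem theorem5_general (N d : ℕ) (hN : 2 ≤ N) (hd : 1 ≤ d) (p : ℕ → unitInterval) :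
    (FatFractal.InfiniteProductEq (fun n => (p n : ℝ) ^ (N ^ (d * n))) 0 →
      ∀ᵐ ω ∂(FatFractal.fatLaw N d p), interior (FatFractal.limitSet ω) = ∅) ∧
    ((∃ L : ℝ, 0 < L ∧ FatFractal.InfiniteProductEq (fun n => (p n : ℝ) ^ (N ^ n)) L) →
      ∀ᵐ ω ∂(FatFractal.fatLaw N d p), volume (FatFractal.dust ω) = 0) ∧
    ((∃ L : ℝ, 0 < L ∧ FatFractal.InfiniteProductEq (fun n => (p n : ℝ) ^ (N ^ (d * n))) L) →
      ∀ᵐ ω ∂(FatFractal.fatLaw N d p), ∃ S : Finset (FatFractal.Index N d),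
        FatFractal.limitSet ω = ⋃ I ∈ S, FatFractal.cube I.2) := by
  refine ⟨FatFractal.ae_interior_limitSet_eq_empty hN, ?_, ?_⟩
  · rintro ⟨L, hL, h⟩
    exact FatFractal.ae_volume_dust_eq_zero (by omega) hd hL h
  · rintro ⟨L, hL, h⟩
    exact FatFractal.ae_exists_limitSet_eq_biUnion_cube (by omega) hL h

theorem theorem5 (N d : ℕ) (hN : 2 ≤ N) (hd : 2 ≤ d) (p : ℕ → unitInterval)
    (hpos : ∀ n, 1 ≤ n → 0 < (p n : ℝ))
    (hmono : ∀ m n, 1 ≤ m → m ≤ n → (p m : ℝ) ≤ (p n : ℝ))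
    (hprod : ∃ L : ℝ, 0 < L ∧ FatFractal.InfiniteProductEq (fun n => (p n : ℝ)) L) :
    (FatFractal.InfiniteProductEq (fun n => (p n : ℝ) ^ (N ^ (d * n))) 0 →
      ∀ᵐ ω ∂(FatFractal.fatLaw N d p), interior (FatFractal.limitSet ω) = ∅) ∧
    ((∃ L : ℝ, 0 < L ∧ FatFractal.InfiniteProductEq (fun n => (p n : ℝ) ^ (N ^ n)) L) →
      ∀ᵐ ω ∂(FatFractal.fatLaw N d p), volume (FatFractal.dust ω) = 0) ∧
    ((∃ L : ℝ, 0 < L ∧ FatFractal.InfiniteProductEq (fun n => (p n : ℝ) ^ (N ^ (d * n))) L) →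
      ∀ᵐ ω ∂(FatFractal.fatLaw N d p), ∃ S : Finset (FatFractal.Index N d),
        FatFractal.limitSet ω = ⋃ I ∈ S, FatFractal.cube I.2) :=
  theorem5_general N d hN (by omega) p
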